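/- Let $r$ and $n$ be integers with $1\le r<n$, and let $K_{2n}$ be the complete graph with vertex set $V$, $|V|=2n$, and edge set $E=\binom{V}{2}$. An \emph{$r$-matching} is a set of $r$ pairwise disjoint edges of $K_{2n}$; let $\mathcal{M}^r_n$ be the family of all $r$-matchings, and for $e\in E$ let $\mathcal{M}^r_n(e)=\{A\in\mathcal{M}^r_n : e\in A\}$ be the star centered at $e$. Put $$\phi(n,r)=\frac{1}{(r-1)!}\prod_{i=1}^{r-1}\binom{2n-2i}{2}.$$ If $\mathcal{A}\subseteq\mathcal{M}^r_n$ is an intersecting family, i.e. any two members of $\mathcal{A}$ share at least one edge, then $|\mathcal{A}|\le\phi(n,r)$, and equality holds if and only if $\mathcal{A}=\mathcal{M}^r_n(e)$ for some $e\in E$. (In particular, $\phi(n,r)$ is the number of $r$-matchings containing any given edge.) -/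

import Mathlib

/-- The family of all `r`-matchings of the complete graph on the vertex set `Fin (2 * n)`:
the sets of `r` edges that pairwise have no common vertex. -/
def rMatchings (n r : ℕ) : Finset (Finset (Sym2 (Fin (2 * n)))) :=
  {M ∈ (⊤ : SimpleGraph (Fin (2 * n))).edgeFinset.powersetCard r |
    ∀ e ∈ M, ∀ f ∈ M, e ≠ f → ∀ v, v ∈ e → v ∉ f}

/-- The star centered at the edge `e`: all `r`-matchings that contain `e`. -/
def matchingStar (n r : ℕ) (e : Sym2 (Fin (2 * n))) : Finset (Finset (Sym2 (Fin (2 * n)))) :=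
  {M ∈ rMatchings n r | e ∈ M}

/-- The number
`φ(n, r) = C(2n-2, 2) * C(2n-4, 2) * ... * C(2n-2(r-1), 2) / (r-1)!`, for `1 ≤ r ≤ n`. -/
def matchingPhi (n r : ℕ) : ℚ :=
  (∏ i ∈ Finset.Icc 1 (r - 1), ((2 * n - 2 * i).choose 2 : ℚ)) / ((r - 1).factorial : ℚ)

/-!
Katona's cycle method. Play a round-robin tournament on the vertices match after match: this is a
cyclic arrangement of all `N = n (2n - 1)` edges in which any `r < n` consecutive ones, a *window*,
form a matching. An intersecting family contains at most `r` of the `N` windows of an arrangement,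
and averaging over all relabellings of the vertices gives `N |𝒜| ≤ r |𝓜|` for the family `𝓜` of all
`r`-matchings. This is the bound, because each edge lies in the same number of matchings.

If equality holds, then in every relabelled arrangement the members of `𝒜` among the windows are
exactly those through one position, its *center*. That `p` is the center is detected by two
consecutive windows, one containing `p` and the other just missing it. So the permutations that fix
two such windows preserve the property that `p` is the center, and for `r ≥ 3` they generate all
transpositions of endpoints of the other edges of the window starting at `p`. If some member `B` of
`𝒜` missed the edge at `p`, such transpositions would move those other edges off `B`, producing a
member of `𝒜` disjoint from `B`. For `r = 2` the only other possibility is a triangle, which is too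
small.
-/

open Equiv
open scoped Pointwise

section Arc

variable {N r s : ℕ}

theorem natCast_zmod_inj {a b : ℕ} (ha : a < N) (hb : b < N)
    (h : (a : ZMod N) = (b : ZMod N)) : a = b := by
  rwa [ZMod.natCast_eq_natCast_iff', Nat.mod_eq_of_lt ha, Nat.mod_eq_of_lt hb] at h

/-- The `r` consecutive positions starting at `i` on a cycle of length `N`. -/
def arc (r : ℕ) (i : ZMod N) : Finset (ZMod N) :=
  (Finset.range r).image fun k : ℕ => i + (k : ZMod N)

theorem mem_arc {i x : ZMod N} : x ∈ arc r i ↔ ∃ k < r, i + (k : ZMod N) = x := by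
  simp only [arc, Finset.mem_image, Finset.mem_range]

theorem card_arc (hr : r ≤ N) (i : ZMod N) : (arc r i).card = r := by
  rw [arc, Finset.card_image_of_injOn, Finset.card_range]
  intro a ha b hb hab
  simp only [Finset.coe_range, Set.mem_Iio] at ha hb
  exact natCast_zmod_inj (by omega) (by omega) (add_left_cancel hab)

theorem arc_succ (r : ℕ) (i : ZMod N) : arc (r + 1) i = insert (i + r) (arc r i) := by
  rw [arc, Finset.range_add_one, Finset.image_insert, arc]

theorem arc_succ' (r : ℕ) (i : ZMod N) : arc (r + 1) i = insert i (arc r (i + 1)) := by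
  ext x
  simp only [mem_arc, Finset.mem_insert, Nat.exists_lt_succ_left, Nat.cast_zero, add_zero,
    Nat.cast_add, Nat.cast_one, eq_comm (a := i), add_assoc, add_comm (1 : ZMod N)]

theorem mem_arc_add_one_sub {p x : ZMod N} : x ∈ arc r (p + 1 - (r : ZMod N)) ↔ p ∈ arc r x := by
  rw [mem_arc, mem_arc]
  constructor <;> rintro ⟨k, hk, rfl⟩ <;> refine ⟨r - 1 - k, by omega, ?_⟩ <;>
    rw [Nat.cast_sub (by omega), Nat.cast_sub (by omega), Nat.cast_one] <;> ring

theorem disjoint_arc_add {d : ℕ} (hr : r ≤ d) (hN : d + s ≤ N) (i : ZMod N) :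
    Disjoint (arc r i) (arc s (i + d)) := by
  refine Finset.disjoint_left.2 fun x hx hx' => ?_
  obtain ⟨a, ha, rfl⟩ := mem_arc.1 hx
  obtain ⟨b, hb, hab⟩ := mem_arc.1 hx'
  rw [add_assoc, add_right_inj, ← Nat.cast_add] at hab
  have := natCast_zmod_inj (by omega) (by omega) hab
  omega

theorem notMem_arc_add_one (hN : r < N) (i : ZMod N) : i ∉ arc r (i + 1) := by
  have hdisj := disjoint_arc_add (r := 1) (s := r) le_rfl (by omega) i
  rw [Nat.cast_one] at hdisj
  exact Finset.disjoint_left.1 hdisj (mem_arc.2 ⟨0, one_pos, by simp⟩)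

theorem add_notMem_arc (hN : r < N) (i : ZMod N) : i + r ∉ arc r i :=
  Finset.disjoint_right.1 (disjoint_arc_add (s := 1) le_rfl hN i) (mem_arc.2 ⟨0, one_pos, by simp⟩)

theorem arc_sdiff_arc_add_one (hN : r + 1 < N) (i : ZMod N) :
    arc (r + 1) i \ arc (r + 1) (i + 1) = {i} := by
  rw [arc_succ', Finset.insert_sdiff_of_notMem _ (notMem_arc_add_one hN i),
    Finset.sdiff_eq_empty_iff_subset.2 (arc_succ r (i + 1) ▸ Finset.subset_insert _ _),
    insert_empty_eq]

theorem arc_add_one_sdiff_arc (hN : r + 1 < N) (i : ZMod N) :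
    arc (r + 1) (i + 1) \ arc (r + 1) i = {i + (r + 1 : ℕ)} := by
  have hlast : i + 1 + (r : ZMod N) = i + (r + 1 : ℕ) := by
    push_cast
    ring
  rw [arc_succ r (i + 1), hlast, Finset.insert_sdiff_of_notMem _ (add_notMem_arc hN i),
    Finset.sdiff_eq_empty_iff_subset.2 (arc_succ' r i ▸ Finset.subset_insert _ _),
    insert_empty_eq]

theorem eq_add_or_eq_add_sub_of_not_disjoint_arc {x y : ZMod N}
    (h : ¬ Disjoint (arc r x) (arc r y)) :
    ∃ i < r, y = x + (i : ZMod N) ∨ y = x + (i : ZMod N) - (r : ZMod N) := by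
  obtain ⟨z, hx, hy⟩ := Finset.not_disjoint_iff.1 h
  obtain ⟨a, ha, rfl⟩ := mem_arc.1 hx
  obtain ⟨b, hb, hab⟩ := mem_arc.1 hy
  rcases le_or_gt b a with hba | hba
  · refine ⟨a - b, by omega, Or.inl ?_⟩
    rw [Nat.cast_sub hba]
    linear_combination hab
  · refine ⟨a + r - b, by omega, Or.inr ?_⟩
    rw [Nat.cast_sub (by omega), Nat.cast_add]
    linear_combination hab

variable {S : Finset (ZMod N)}

theorem card_le_of_pairwise_not_disjoint_arc_of_cover (hN : 2 * r ≤ N)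
    (hS : ∀ x ∈ S, ∀ y ∈ S, ¬ Disjoint (arc r x) (arc r y)) (x : ZMod N) (I : Finset ℕ)
    (hI : ∀ y ∈ S, ∃ i ∈ I, y = x + (i : ZMod N) ∨ y = x + (i : ZMod N) - (r : ZMod N)) :
    S.card ≤ I.card := by
  have hpair (z : ZMod N) : ¬ (z ∈ S ∧ z - r ∈ S) := fun ⟨hz, hz'⟩ =>
    hS _ hz' _ hz (by simpa using disjoint_arc_add le_rfl (by omega : r + r ≤ N) (z - r))
  refine Finset.card_le_card_of_forall_subsingleton
    (fun y (i : ℕ) => y = x + (i : ZMod N) ∨ y = x + (i : ZMod N) - (r : ZMod N)) hI ?_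
  rintro i - y ⟨hy, rfl | rfl⟩ z ⟨hz, rfl | rfl⟩
  · rfl
  · exact absurd ⟨hy, hz⟩ (hpair _)
  · exact absurd ⟨hz, hy⟩ (hpair _)
  · rfl

theorem card_le_of_pairwise_not_disjoint_arc (hN : 2 * r ≤ N)
    (hS : ∀ x ∈ S, ∀ y ∈ S, ¬ Disjoint (arc r x) (arc r y)) : S.card ≤ r := by
  rcases S.eq_empty_or_nonempty with rfl | ⟨x, hx⟩
  · exact zero_le
  · refine (card_le_of_pairwise_not_disjoint_arc_of_cover hN hS x (Finset.range r)
      fun y hy => ?_).trans_eq (Finset.card_range r)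
    simpa only [Finset.mem_range] using
      eq_add_or_eq_add_sub_of_not_disjoint_arc (hS x hx y hy)

theorem mem_or_sub_mem_of_card_eq (hN : 2 * r ≤ N)
    (hS : ∀ x ∈ S, ∀ y ∈ S, ¬ Disjoint (arc r x) (arc r y)) (hcard : S.card = r)
    {x : ZMod N} (hx : x ∈ S) {i : ℕ} (hi : i < r) :
    x + (i : ZMod N) ∈ S ∨ x + (i : ZMod N) - (r : ZMod N) ∈ S := by
  by_contra! hcon
  have hle := card_le_of_pairwise_not_disjoint_arc_of_cover hN hS x ((Finset.range r).erase i)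
    fun y hy => by
      obtain ⟨j, hj, h⟩ := eq_add_or_eq_add_sub_of_not_disjoint_arc (hS x hx y hy)
      refine ⟨j, Finset.mem_erase.2 ⟨?_, Finset.mem_range.2 hj⟩, h⟩
      rintro rfl
      rcases h with rfl | rfl
      exacts [hcon.1 hy, hcon.2 hy]
  rw [Finset.card_erase_of_mem (Finset.mem_range.2 hi), Finset.card_range] at hle
  omega

theorem exists_forall_mem_iff_mem_arc (hr : 0 < r) (hN : 2 * r < N)
    (hS : ∀ x ∈ S, ∀ y ∈ S, ¬ Disjoint (arc r x) (arc r y)) (hcard : S.card = r) :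
    ∃ p, ∀ x, x ∈ S ↔ p ∈ arc r x := by
  have hnotMem {x y : ZMod N} {d : ℕ} (hd : r ≤ d) (hd' : d + r ≤ N) (hx : x ∈ S)
      (hxy : x + d = y) : y ∉ S :=
    fun hy => hS x hx y hy (hxy ▸ disjoint_arc_add hd hd' x)
  obtain ⟨p, hp, hp'⟩ : ∃ p ∈ S, p + 1 ∉ S := by
    by_contra! hclosed
    obtain ⟨x, hx⟩ := Finset.card_pos.1 (hcard ▸ hr)
    have hadd (k : ℕ) : x + (k : ZMod N) ∈ S := by
      induction k with
      | zero => simpa using hx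
      | succ k ih => simpa [add_assoc] using hclosed _ ih
    exact hnotMem le_rfl (by omega) hx rfl (hadd r)
  have hright (i : ℕ) (hi : i < r) : p + (i + 1 : ℕ) ∉ S := by
    induction i with
    | zero => simpa using hp'
    | succ i ih =>
      have := (mem_or_sub_mem_of_card_eq hN.le hS hcard hp hi).resolve_left (ih (by omega))
      exact hnotMem (d := r + 1) (by omega) (by omega) this (by push_cast; ring)
  have hsub : arc r (p + 1 - (r : ZMod N)) ⊆ S := by
    intro x hx
    obtain ⟨k, hk, rfl⟩ := mem_arc.1 hx
    rcases (Nat.succ_le_of_lt hk).eq_or_lt with rfl | hk'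
    · convert hp using 1
      push_cast; ring
    · convert (mem_or_sub_mem_of_card_eq hN.le hS hcard hp hk').resolve_left (hright k hk) using 1
      push_cast; ring
  have heq := Finset.eq_of_subset_of_card_le hsub (by rw [card_arc (by omega), hcard])
  exact ⟨p, fun x => by rw [← heq, mem_arc_add_one_sub]⟩

end Arc

section Katona

theorem card_filter_smul_eq {G α : Type*} [Group G] [Fintype G] [MulAction G α]
    [DecidableEq α] {x y : α} (hy : y ∈ MulAction.orbit G x) :
    ({g : G | g • x = y} : Finset G).card = Nat.card (MulAction.stabilizer G x) := by
  obtain ⟨h, rfl⟩ := hy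
  rw [← Fintype.card_subtype, ← Nat.card_eq_fintype_card]
  refine (Nat.card_congr ((Equiv.mulLeft h).subtypeEquiv fun g => ?_)).symm
  rw [Equiv.coe_mulLeft, mul_smul, smul_left_cancel_iff, MulAction.mem_stabilizer_iff]

theorem card_filter_smul_mem_mul_card {G α : Type*} [Group G] [Fintype G] [MulAction G α]
    [DecidableEq α] {A X : Finset α} {x : α} (hX : MulAction.orbit G x = X) (hA : A ⊆ X) :
    ({g : G | g • x ∈ A} : Finset G).card * X.card = A.card * Fintype.card G := by
  have hfiber : ∀ y ∈ A, ({g ∈ ({g : G | g • x ∈ A} : Finset G) | g • x = y}).card =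
      Nat.card (MulAction.stabilizer G x) := by
    intro y hy
    rw [← card_filter_smul_eq (hX ▸ hA hy : y ∈ MulAction.orbit G x), Finset.filter_filter]
    exact congrArg Finset.card (Finset.filter_congr fun g _ => and_iff_right_of_imp fun h => h ▸ hy)
  have hcard : X.card * Nat.card (MulAction.stabilizer G x) = Nat.card G := by
    rw [← Subgroup.index_mul_card (MulAction.stabilizer G x), MulAction.index_stabilizer, hX,
      Set.ncard_coe_finset]
  rw [Finset.card_eq_sum_card_fiberwise (f := (· • x)) (t := A) fun g hg => by simpa using hg,
    Finset.sum_const_nat hfiber, ← Nat.card_eq_fintype_card, ← hcard]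
  ring

variable {G E : Type*} [Group G] [MulAction G E] [DecidableEq E] {N r : ℕ}

/-- The image of an arc of length `r` under a cyclic arrangement `c`: the sets that Katona's cycle
method averages over. -/
def window (c : ZMod N → E) (r : ℕ) (i : ZMod N) : Finset E :=
  (arc r i).image c

variable {c : ZMod N → E} {A X : Finset (Finset E)}

theorem card_window (hc : c.Injective) (hr : r ≤ N) (i : ZMod N) : (window c r i).card = r := by
  rw [window, Finset.card_image_of_injective _ hc, card_arc hr]

theorem mem_window (hc : c.Injective) {p i : ZMod N} : c p ∈ window c r i ↔ p ∈ arc r i :=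
  hc.mem_finset_image

theorem disjoint_window (hc : c.Injective) {s : ℕ} {i j : ZMod N} :
    Disjoint (window c r i) (window c s j) ↔ Disjoint (arc r i) (arc s j) :=
  Finset.disjoint_image hc

theorem window_succ (r : ℕ) (i : ZMod N) :
    window c (r + 1) i = insert (c (i + r)) (window c r i) := by
  rw [window, arc_succ, Finset.image_insert, window]

theorem window_succ' (r : ℕ) (i : ZMod N) :
    window c (r + 1) i = insert (c i) (window c r (i + 1)) := by
  rw [window, arc_succ', Finset.image_insert, window]

variable [NeZero N]

/-- The starting points of the windows of the arrangement `g • c` that belong to `A`. -/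
def windowStarts (A : Finset (Finset E)) (c : ZMod N → E) (r : ℕ) (g : G) : Finset (ZMod N) :=
  {i | g • window c r i ∈ A}

theorem mem_windowStarts {g : G} {i : ZMod N} :
    i ∈ windowStarts A c r g ↔ g • window c r i ∈ A := by
  rw [windowStarts, Finset.mem_filter_univ]

theorem not_disjoint_arc_of_mem_windowStarts (hc : c.Injective)
    (hA : (A : Set (Finset E)).Intersecting) {g : G} :
    ∀ i ∈ windowStarts A c r g, ∀ j ∈ windowStarts A c r g, ¬ Disjoint (arc r i) (arc r j) := by
  intro i hi j hj h
  rw [mem_windowStarts] at hi hj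
  refine hA hi hj ?_
  rw [Finset.smul_finset_def, Finset.smul_finset_def,
    Finset.disjoint_image (MulAction.injective g), disjoint_window hc]
  exact h

theorem card_windowStarts_le (hc : c.Injective) (hN : 2 * r ≤ N)
    (hA : (A : Set (Finset E)).Intersecting) (g : G) : (windowStarts A c r g).card ≤ r :=
  card_le_of_pairwise_not_disjoint_arc hN (not_disjoint_arc_of_mem_windowStarts hc hA)

theorem sum_card_windowStarts_mul_card [Fintype G] (hX : ∀ i, MulAction.orbit G (window c r i) = X)
    (hAX : A ⊆ X) :
    (∑ g : G, (windowStarts A c r g).card) * X.card = N * A.card * Fintype.card G := by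
  have hcomm : ∑ g : G, (windowStarts A c r g).card =
      ∑ i, ({g : G | g • window c r i ∈ A} : Finset G).card :=
    Finset.sum_card_bipartiteAbove_eq_sum_card_bipartiteBelow fun g i => g • window c r i ∈ A
  rw [hcomm, Finset.sum_mul,
    Finset.sum_congr rfl fun i _ => card_filter_smul_mem_mul_card (hX i) hAX,
    Finset.sum_const, Finset.card_univ, ZMod.card, smul_eq_mul, mul_assoc]

variable [Finite G]

theorem mul_card_le_of_intersecting (hc : c.Injective) (hN : 2 * r ≤ N)
    (hX : ∀ i, MulAction.orbit G (window c r i) = X) (hAX : A ⊆ X)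
    (hA : (A : Set (Finset E)).Intersecting) : N * A.card ≤ r * X.card := by
  have := Fintype.ofFinite G
  refine Nat.le_of_mul_le_mul_right ?_ (Fintype.card_pos (α := G))
  calc N * A.card * Fintype.card G = (∑ g : G, (windowStarts A c r g).card) * X.card :=
        (sum_card_windowStarts_mul_card hX hAX).symm
    _ ≤ (Fintype.card G * r) * X.card := by
        gcongr
        exact Finset.sum_le_card_nsmul _ _ _ fun g _ => card_windowStarts_le hc hN hA g
    _ = r * X.card * Fintype.card G := by ring

theorem card_windowStarts_eq (hc : c.Injective) (hN : 2 * r ≤ N)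
    (hX : ∀ i, MulAction.orbit G (window c r i) = X) (hAX : A ⊆ X)
    (hA : (A : Set (Finset E)).Intersecting) (heq : N * A.card = r * X.card) (g : G) :
    (windowStarts A c r g).card = r := by
  have := Fintype.ofFinite G
  have hXpos : 0 < X.card := Finset.card_pos.2
    ⟨window c r 0, Finset.mem_coe.1 (hX 0 ▸ MulAction.mem_orbit_self _)⟩
  have hsum : ∑ g : G, (windowStarts A c r g).card = ∑ _g : G, r := by
    refine Nat.eq_of_mul_eq_mul_right hXpos ?_
    rw [sum_card_windowStarts_mul_card hX hAX, heq, Finset.sum_const, Finset.card_univ, smul_eq_mul]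
    ring
  exact (Finset.sum_eq_sum_iff_of_le fun g _ => card_windowStarts_le hc hN hA g).1 hsum g
    (Finset.mem_univ g)

end Katona

section Center

variable {G E : Type*} [Group G] [MulAction G E] [DecidableEq E] {N r : ℕ}

/-- The windows of the arrangement `g • c` that belong to `A` are those through position `p`. -/
def IsCenter (A : Finset (Finset E)) (c : ZMod N → E) (r : ℕ) (p : ZMod N) (g : G) : Prop :=
  ∀ i, g • window c r i ∈ A ↔ p ∈ arc r i

variable {c : ZMod N → E} {A X : Finset (Finset E)}

theorem exists_isCenter [NeZero N] [Finite G] (hc : c.Injective) (hr : 0 < r) (hN : 2 * r < N)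
    (hX : ∀ i, MulAction.orbit G (window c r i) = X) (hAX : A ⊆ X)
    (hA : (A : Set (Finset E)).Intersecting) (heq : N * A.card = r * X.card) (g : G) :
    ∃ p, IsCenter A c r p g := by
  obtain ⟨p, hp⟩ := exists_forall_mem_iff_mem_arc hr hN
    (not_disjoint_arc_of_mem_windowStarts (g := g) hc hA)
    (card_windowStarts_eq hc hN.le hX hAX hA heq g)
  exact ⟨p, fun i => by rw [← hp, mem_windowStarts]⟩

/-- The permutations that preserve, by right multiplication, the set of arrangements with
center `p`. -/
def centerSubgroup (G : Type*) [Group G] [MulAction G E] (A : Finset (Finset E)) (c : ZMod N → E)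
    (r : ℕ) (p : ZMod N) : Subgroup G where
  carrier := {h | ∀ g : G, IsCenter A c r p (g * h) ↔ IsCenter A c r p g}
  one_mem' g := by rw [mul_one]
  mul_mem' {a b} ha hb g := by rw [← mul_assoc, hb, ha]
  inv_mem' {a} ha g := by rw [← ha, inv_mul_cancel_right]

theorem IsCenter.mul {p : ZMod N} {g h : G} (hg : IsCenter A c r p g)
    (hh : h ∈ centerSubgroup G A c r p) : IsCenter A c r p (g * h) :=
  (hh g).2 hg

theorem isCenter_iff_of_arc_sdiff_arc (hcen : ∀ g : G, ∃ p, IsCenter A c r p g)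
    {i j p : ZMod N} (hij : arc r i \ arc r j = {p}) {g : G} :
    IsCenter A c r p g ↔ g • window c r i ∈ A ∧ g • window c r j ∉ A := by
  have hmem (q : ZMod N) : q ∈ arc r i ∧ q ∉ arc r j ↔ q = p := by
    rw [← Finset.mem_sdiff, hij, Finset.mem_singleton]
  constructor
  · intro h
    rw [h i, h j, hmem]
  · rintro h
    obtain ⟨q, hq⟩ := hcen g
    rw [hq i, hq j, hmem] at h
    exact h ▸ hq

theorem stabilizer_inf_stabilizer_le_centerSubgroup (hcen : ∀ g : G, ∃ p, IsCenter A c r p g)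
    {i j p : ZMod N} (hij : arc r i \ arc r j = {p}) :
    MulAction.stabilizer G (window c r i) ⊓ MulAction.stabilizer G (window c r j) ≤
      centerSubgroup G A c r p := by
  rintro h ⟨hi, hj⟩ g
  rw [isCenter_iff_of_arc_sdiff_arc hcen hij, isCenter_iff_of_arc_sdiff_arc hcen hij, mul_smul,
    mul_smul, MulAction.mem_stabilizer_iff.1 hi, MulAction.mem_stabilizer_iff.1 hj]

end Center

/-- The action on unordered pairs induced by an action on points. -/
instance sym2MulAction {G V : Type*} [Monoid G] [MulAction G V] : MulAction G (Sym2 V) where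
  smul g := Sym2.map (g • ·)
  one_smul e := by
    change Sym2.map _ e = e
    simp only [one_smul, Sym2.map_id', id]
  mul_smul g h e := by
    change Sym2.map _ e = Sym2.map _ (Sym2.map _ e)
    simp only [Sym2.map_map, Function.comp_def, mul_smul]

section Sym2Action

variable {G V : Type*} [Group G] [MulAction G V] {g : G} {v : V} {e : Sym2 V}

theorem smul_sym2_mk (g : G) (a b : V) : g • s(a, b) = s(g • a, g • b) :=
  rfl

theorem mem_smul_sym2 : v ∈ g • e ↔ g⁻¹ • v ∈ e := by
  induction e with
  | _ a b => simp only [smul_sym2_mk, Sym2.mem_iff, inv_smul_eq_iff]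

theorem isDiag_smul_sym2 : (g • e).IsDiag ↔ e.IsDiag :=
  Sym2.isDiag_map (MulAction.injective g)

theorem smul_sym2_eq_self (h : ∀ v ∈ e, g • v = v) : g • e = e := by
  induction e with
  | _ a b => rw [smul_sym2_mk, h a (Sym2.mem_mk_left a b), h b (Sym2.mem_mk_right a b)]

end Sym2Action

/-- A set of pairwise disjoint edges, none of which is a loop. -/
structure IsEdgeMatching {V : Type*} (M : Finset (Sym2 V)) : Prop where
  not_isDiag : ∀ e ∈ M, ¬ e.IsDiag
  eq_of_mem : ∀ e ∈ M, ∀ f ∈ M, ∀ v, v ∈ e → v ∈ f → e = f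

namespace IsEdgeMatching

variable {V : Type*} {M M' : Finset (Sym2 V)}

theorem subset (hM : IsEdgeMatching M) (h : M' ⊆ M) : IsEdgeMatching M' where
  not_isDiag e he := hM.not_isDiag e (h he)
  eq_of_mem e he f hf := hM.eq_of_mem e (h he) f (h hf)

theorem ne (hM : IsEdgeMatching M) {a b : V} (h : s(a, b) ∈ M) : a ≠ b :=
  fun hab => hM.not_isDiag _ h (Sym2.mk_isDiag_iff.2 hab)

theorem notMem (hM : IsEdgeMatching M) {e f : Sym2 V} (he : e ∈ M) (hf : f ∈ M) (hne : e ≠ f)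
    {v : V} (hv : v ∈ e) : v ∉ f :=
  fun hv' => hne (hM.eq_of_mem e he f hf v hv hv')

theorem exists_injective_endpoints (hM : IsEdgeMatching M) :
    ∃ f : M × Bool → V, f.Injective ∧ ∀ e : M, s(f (e, true), f (e, false)) = e := by
  refine ⟨fun x => cond x.2 x.1.1.out.1 x.1.1.out.2, ?_, fun e => Quot.out_eq e.1⟩
  have hmem (x : M × Bool) : cond x.2 x.1.1.out.1 x.1.1.out.2 ∈ x.1.1 := by
    cases x.2
    exacts [Sym2.out_snd_mem _, Sym2.out_fst_mem _]
  have hne (e : M) : e.1.out.1 ≠ e.1.out.2 :=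
    hM.ne (by rw [show s(e.1.out.1, e.1.out.2) = e.1 from Quot.out_eq e.1]; exact e.2)
  rintro ⟨e, a⟩ ⟨f, b⟩ h
  obtain rfl : e = f := Subtype.ext <|
    hM.eq_of_mem _ e.2 _ f.2 _ (hmem (e, a)) ((congrArg (· ∈ f.1) h).mpr (hmem (f, b)))
  cases a <;> cases b
  exacts [rfl, absurd h.symm (hne e), absurd h (hne e), rfl]

variable [DecidableEq V]

theorem notMem_of_insert {e f : Sym2 V} (hM : IsEdgeMatching (insert e M)) (he : e ∉ M)
    (hf : f ∈ M) {v : V} (hv : v ∈ f) : v ∉ e :=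
  hM.notMem (Finset.mem_insert_of_mem hf) (Finset.mem_insert_self e M) (fun h => he (h ▸ hf)) hv

theorem smul {G : Type*} [Group G] [MulAction G V] (hM : IsEdgeMatching M) (g : G) :
    IsEdgeMatching (g • M) where
  not_isDiag e he := by
    rw [Finset.mem_smul_finset] at he
    obtain ⟨e, he, rfl⟩ := he
    exact fun h => hM.not_isDiag e he (isDiag_smul_sym2.1 h)
  eq_of_mem e he f hf v hv hv' := by
    rw [Finset.mem_smul_finset] at he hf
    obtain ⟨e, he, rfl⟩ := he
    obtain ⟨f, hf, rfl⟩ := hf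
    rw [hM.eq_of_mem e he f hf _ (mem_smul_sym2.1 hv) (mem_smul_sym2.1 hv')]

theorem exists_smul_eq [Finite V] (hM : IsEdgeMatching M) (hM' : IsEdgeMatching M')
    (hcard : M.card = M'.card) : ∃ σ : Perm V, σ • M = M' := by
  obtain ⟨f, hf, hfe⟩ := hM.exists_injective_endpoints
  obtain ⟨f', hf', hfe'⟩ := hM'.exists_injective_endpoints
  let φ : M ≃ M' := Finset.equivOfCardEq hcard
  obtain ⟨σ, hσ⟩ := Equiv.Perm.exists_extending_pair f (fun x => f' (φ x.1, x.2)) hf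
    (hf'.comp (φ.injective.prodMap Function.injective_id))
  have hσe (e : M) : σ • e.1 = φ e := by
    rw [← hfe e, ← hfe' (φ e), smul_sym2_mk, Perm.smul_def, Perm.smul_def, hσ, hσ]
  refine ⟨σ, Finset.eq_of_subset_of_card_le (fun e he => ?_) ?_⟩
  · obtain ⟨f, hf, rfl⟩ := Finset.mem_smul_finset.1 he
    exact hσe ⟨f, hf⟩ ▸ (φ ⟨f, hf⟩).2
  · rw [Finset.card_smul_finset, hcard]

theorem swap_mul_swap_mem_stabilizer (hM : IsEdgeMatching M) {a b c d : V} (hab : s(a, b) ∈ M)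
    (hcd : s(c, d) ∈ M) (hne : s(a, b) ≠ s(c, d)) :
    swap a c * swap b d ∈ MulAction.stabilizer (Perm V) M := by
  have hab' := hM.ne hab
  have hcd' := hM.ne hcd
  have ha := hM.notMem hab hcd hne (Sym2.mem_mk_left a b)
  have hb := hM.notMem hab hcd hne (Sym2.mem_mk_right a b)
  rw [Sym2.mem_iff, not_or] at ha hb
  refine MulAction.mem_stabilizer_finset'.2 fun e he => ?_
  by_cases heab : e = s(a, b)
  · rwa [heab, smul_sym2_mk, Perm.smul_def, Perm.smul_def, Perm.mul_apply, Perm.mul_apply,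
      swap_apply_of_ne_of_ne hab' ha.2, swap_apply_left, swap_apply_left,
      swap_apply_of_ne_of_ne (Ne.symm ha.2) hcd'.symm]
  by_cases hecd : e = s(c, d)
  · rwa [hecd, smul_sym2_mk, Perm.smul_def, Perm.smul_def, Perm.mul_apply, Perm.mul_apply,
      swap_apply_of_ne_of_ne (Ne.symm hb.1) hcd', swap_apply_right, swap_apply_right,
      swap_apply_of_ne_of_ne hab'.symm hb.1]
  rwa [smul_sym2_eq_self fun v hv => ?_]
  have hvab := hM.notMem he hab heab hv
  have hvcd := hM.notMem he hcd hecd hv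
  rw [Sym2.mem_iff, not_or] at hvab hvcd
  rw [Perm.smul_def, Perm.mul_apply, swap_apply_of_ne_of_ne hvab.2 hvcd.2,
    swap_apply_of_ne_of_ne hvab.1 hvcd.1]

end IsEdgeMatching

theorem swap_mem_stabilizer_of_forall_mem_iff {V : Type*} [DecidableEq V] {M : Finset (Sym2 V)}
    {a b : V} (h : ∀ e ∈ M, a ∈ e ↔ b ∈ e) : swap a b ∈ MulAction.stabilizer (Perm V) M := by
  refine MulAction.mem_stabilizer_finset'.2 fun e he => ?_
  suffices swap a b • e = e by rwa [this]
  by_cases ha : a ∈ e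
  · obtain ⟨c, rfl⟩ := ha
    rcases Sym2.mem_iff.1 ((h _ he).1 (Sym2.mem_mk_left a c)) with rfl | rfl
    · rw [swap_self, ← Perm.one_def, one_smul]
    · rw [smul_sym2_mk, Perm.smul_def, Perm.smul_def, swap_apply_left, swap_apply_right,
        Sym2.eq_swap]
  · refine smul_sym2_eq_self fun v hv => swap_apply_of_ne_of_ne ?_ ?_
    · rintro rfl
      exact ha hv
    · rintro rfl
      exact ha ((h e he).2 hv)

theorem IsEdgeMatching.swap_mem_stabilizer {V : Type*} [DecidableEq V] {M : Finset (Sym2 V)}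
    (hM : IsEdgeMatching M) {a b : V} (hab : s(a, b) ∈ M) :
    swap a b ∈ MulAction.stabilizer (Perm V) M :=
  swap_mem_stabilizer_of_forall_mem_iff fun e he =>
    ⟨fun ha => hM.eq_of_mem e he _ hab a ha (Sym2.mem_mk_left a b) ▸ Sym2.mem_mk_right a b,
      fun hb => hM.eq_of_mem e he _ hab b hb (Sym2.mem_mk_right a b) ▸ Sym2.mem_mk_left a b⟩

section Swaps

variable {V : Type*} [DecidableEq V] {K : Subgroup (Perm V)} {B M P Q : Finset (Sym2 V)}
  {d e f : Sym2 V}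

-- Conjugating `swap x w` by the exchange of `s(x, y)` with another edge `s(z, u)` gives `swap z w`.
theorem swap_mem_of_mem_link (hP : IsEdgeMatching P)
    (hswap : ∀ a b, s(a, b) ∈ P → swap a b ∈ K)
    (hexch : ∀ a b c d, s(a, b) ∈ P → s(c, d) ∈ P → s(a, b) ≠ s(c, d) →
      swap a c * swap b d ∈ K)
    {x y w : V} (hxy : s(x, y) ∈ P) (hwx : w ≠ x) (hwy : w ≠ y) (hw : swap x w ∈ K)
    {z : V} (he : e ∈ P) (hz : z ∈ e) : swap x z ∈ K := by
  obtain ⟨u, rfl⟩ := hz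
  by_cases heq : s(x, y) = s(z, u)
  · rcases Sym2.eq_iff.1 heq with ⟨rfl, -⟩ | ⟨-, rfl⟩
    · rw [swap_self]
      exact K.one_mem
    · exact hswap _ _ hxy
  by_cases hwz : w = z
  · rwa [← hwz]
  by_cases hwu : w = u
  · subst hwu
    exact SubmonoidClass.swap_mem_trans K hw (swap_comm z w ▸ hswap z w he)
  have hx := hP.notMem hxy he heq (Sym2.mem_mk_left x y)
  rw [Sym2.mem_iff, not_or] at hx
  have hzw : swap z w ∈ K := by
    have hτ := hexch x y z u hxy he heq
    have hconj := K.mul_mem (K.mul_mem hτ hw) (K.inv_mem hτ)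
    rwa [← swap_apply_apply, Perm.mul_apply, Perm.mul_apply,
      swap_apply_of_ne_of_ne (hP.ne hxy) hx.2, swap_apply_left,
      swap_apply_of_ne_of_ne hwy hwu, swap_apply_of_ne_of_ne hwx hwz] at hconj
  exact SubmonoidClass.swap_mem_trans K hw (swap_comm z w ▸ hzw)

theorem exists_card_swap_smul_inter_lt (hP : IsEdgeMatching P) (hB : IsEdgeMatching B)
    (hcard : 1 < P.card) (he : e ∈ P) (heB : e ∈ B) :
    ∃ f ∈ P, ∃ x ∈ e, ∃ y ∈ f, (swap x y • P ∩ B).card < (P ∩ B).card := by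
  obtain ⟨f, hf, hfe⟩ := Finset.exists_mem_ne hcard e
  induction e with | _ a x =>
  induction f with | _ y b =>
  refine ⟨s(y, b), hf, x, Sym2.mem_mk_right a x, y, Sym2.mem_mk_left y b, ?_⟩
  have ha := hP.notMem he hf hfe.symm (Sym2.mem_mk_left a x)
  have hx := hP.notMem he hf hfe.symm (Sym2.mem_mk_right a x)
  rw [Sym2.mem_iff, not_or] at ha hx
  have hsub : swap x y • P ∩ B ⊆ (P ∩ B).erase s(a, x) := by
    intro g' hg'
    rw [Finset.mem_inter, Finset.mem_smul_finset] at hg'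
    obtain ⟨⟨g, hg, rfl⟩, hgB⟩ := hg'
    by_cases hge : g = s(a, x)
    · rw [hge, smul_sym2_mk, Perm.smul_def, Perm.smul_def, swap_apply_left,
        swap_apply_of_ne_of_ne (hP.ne he) ha.1] at hgB
      have := hB.eq_of_mem _ hgB _ heB a (Sym2.mem_mk_left a y) (Sym2.mem_mk_left a x)
      exact absurd (Sym2.congr_right.1 this) (Ne.symm hx.1)
    by_cases hgf : g = s(y, b)
    · rw [hgf, smul_sym2_mk, Perm.smul_def, Perm.smul_def, swap_apply_right,
        swap_apply_of_ne_of_ne (Ne.symm hx.2) (hP.ne hf).symm] at hgB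
      have := hB.eq_of_mem _ hgB _ heB x (Sym2.mem_mk_left x b) (Sym2.mem_mk_right a x)
      rw [Sym2.eq_swap, Sym2.congr_left] at this
      exact absurd this (Ne.symm ha.2)
    have hfix : swap x y • g = g := smul_sym2_eq_self fun v hv => swap_apply_of_ne_of_ne
      (fun h => hP.notMem hg he hge hv (h ▸ Sym2.mem_mk_right a x))
      (fun h => hP.notMem hg hf hgf hv (h ▸ Sym2.mem_mk_left y b))
    rw [hfix] at hgB ⊢
    exact Finset.mem_erase.2 ⟨hge, Finset.mem_inter.2 ⟨hg, hgB⟩⟩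
  exact Finset.card_lt_card
    (hsub.trans_ssubset (Finset.erase_ssubset (Finset.mem_inter.2 ⟨he, heB⟩)))

theorem exists_mem_disjoint_smul {U : Set V} (hK : ∀ x ∈ U, ∀ y ∈ U, swap x y ∈ K)
    (hB : IsEdgeMatching B) (hP : IsEdgeMatching P) (hPU : ∀ e ∈ P, ∀ v ∈ e, v ∈ U)
    (hcard : 1 < P.card) : ∃ h ∈ K, Disjoint (h • P) B := by
  induction hk : (P ∩ B).card using Nat.strong_induction_on generalizing P with
  | _ k ih =>
  by_cases hdisj : Disjoint P B
  · exact ⟨1, K.one_mem, by rwa [one_smul]⟩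
  obtain ⟨e, he, heB⟩ := Finset.not_disjoint_iff.1 hdisj
  obtain ⟨f, hf, x, hx, y, hy, hlt⟩ := exists_card_swap_smul_inter_lt hP hB hcard he heB
  have hxU := hPU e he x hx
  have hyU := hPU f hf y hy
  have hU : ∀ g ∈ swap x y • P, ∀ v ∈ g, v ∈ U := by
    intro g hg v hv
    obtain ⟨g', hg', rfl⟩ := Finset.mem_smul_finset.1 hg
    have hv' := hPU g' hg' _ (mem_smul_sym2.1 hv)
    rw [swap_inv, Perm.smul_def, swap_apply_def] at hv'
    split_ifs at hv' with hvx hvy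
    exacts [hvx ▸ hxU, hvy ▸ hyU, hv']
  obtain ⟨h, hhK, hh⟩ := ih _ (hk ▸ hlt) (hP.smul _) hU
    (by rwa [Finset.card_smul_finset]) rfl
  exact ⟨h * swap x y, K.mul_mem hhK (hK x hxU y hyU), by rwa [mul_smul]⟩

theorem exists_link (hP : IsEdgeMatching P) (hcard : 1 < P.card)
    (hdQ : IsEdgeMatching (insert d Q)) (heQ : IsEdgeMatching (insert e Q))
    (hdisj : Disjoint (insert d Q) P) (hPe : ∀ f ∈ P, ∀ v ∈ f, v ∉ e) :
    ∃ x y w, s(x, y) ∈ P ∧ w ≠ x ∧ w ≠ y ∧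
      swap x w ∈ MulAction.stabilizer (Perm V) (insert d Q) ∧
      swap x w ∈ MulAction.stabilizer (Perm V) (insert e Q) := by
  by_cases hPQ : ∃ f ∈ P, ∃ x ∈ f, ∃ g ∈ Q, x ∈ g
  · obtain ⟨f, hf, x, ⟨y, rfl⟩, g, hg, ⟨w, rfl⟩⟩ := hPQ
    have hgd := Finset.mem_insert_of_mem (b := d) hg
    refine ⟨x, y, w, hf, (hdQ.ne hgd).symm, ?_, hdQ.swap_mem_stabilizer hgd,
      heQ.swap_mem_stabilizer (Finset.mem_insert_of_mem hg)⟩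
    rintro rfl
    exact Finset.disjoint_left.1 hdisj hgd hf
  push Not at hPQ
  have hexists : ∀ f ∈ P, ∃ v ∈ f, v ∉ d := by
    intro f hf
    by_contra! hfd
    obtain rfl : d = f := by
      induction f with | _ a b =>
      exact (Sym2.mem_and_mem_iff (hP.ne hf)).1
        ⟨hfd a (Sym2.mem_mk_left a b), hfd b (Sym2.mem_mk_right a b)⟩
    exact Finset.disjoint_left.1 hdisj (Finset.mem_insert_self d Q) hf
  obtain ⟨f, hf, g, hg, hfg⟩ := Finset.one_lt_card.1 hcard
  obtain ⟨x, ⟨y, rfl⟩, hxd⟩ := hexists f hf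
  obtain ⟨w, hwg, hwd⟩ := hexists g hg
  have hwf := hP.notMem hg hf hfg.symm hwg
  rw [Sym2.mem_iff, not_or] at hwf
  have hiff (k : Sym2 V) (hx : x ∉ k) (hw : w ∉ k) : ∀ k' ∈ insert k Q, x ∈ k' ↔ w ∈ k' :=
    (Finset.forall_mem_insert _ _ _).2 ⟨iff_of_false hx hw, fun k' hk' =>
      iff_of_false (hPQ _ hf x (Sym2.mem_mk_left x y) k' hk') (hPQ g hg w hwg k' hk')⟩
  exact ⟨x, y, w, hf, hwf.1, hwf.2,
    swap_mem_stabilizer_of_forall_mem_iff (hiff d hxd hwd),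
    swap_mem_stabilizer_of_forall_mem_iff
      (hiff e (hPe _ hf x (Sym2.mem_mk_left x y)) (hPe g hg w hwg))⟩

theorem swap_mem_of_stabilizers_le (hPe : IsEdgeMatching (insert e P))
    (hPf : IsEdgeMatching (insert f P)) (hQd : IsEdgeMatching (insert d Q))
    (hQe : IsEdgeMatching (insert e Q)) (he : e ∉ P) (hcard : 1 < P.card)
    (hdisj : Disjoint (insert d Q) P)
    (hKP : MulAction.stabilizer (Perm V) (insert e P) ⊓ MulAction.stabilizer (Perm V) (insert f P)
      ≤ K)
    (hKQ : MulAction.stabilizer (Perm V) (insert d Q) ⊓ MulAction.stabilizer (Perm V) (insert e Q)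
      ≤ K) {z z' : V} (hz : ∃ g ∈ P, z ∈ g) (hz' : ∃ g ∈ P, z' ∈ g) : swap z z' ∈ K := by
  have hP := hPe.subset (Finset.subset_insert e P)
  obtain ⟨x, y, w, hxy, hwx, hwy, hwd, hwe⟩ := exists_link hP hcard hQd hQe hdisj
    fun g hg v hv => hPe.notMem_of_insert he hg hv
  have hfrom_x {u : V} (hu : ∃ g ∈ P, u ∈ g) : swap x u ∈ K := by
    obtain ⟨g, hg, hug⟩ := hu
    have hins {k : Sym2 V} {h : Sym2 V} (hk : k ∈ P) : k ∈ insert h P :=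
      Finset.mem_insert_of_mem hk
    exact swap_mem_of_mem_link hP
      (fun a b hab => hKP ⟨hPe.swap_mem_stabilizer (hins hab), hPf.swap_mem_stabilizer (hins hab)⟩)
      (fun a b a' b' hab hab' hne => hKP
        ⟨hPe.swap_mul_swap_mem_stabilizer (hins hab) (hins hab') hne,
          hPf.swap_mul_swap_mem_stabilizer (hins hab) (hins hab') hne⟩)
      hxy hwx hwy (hKQ ⟨hwd, hwe⟩) hg hug
  exact SubmonoidClass.swap_mem_trans K (swap_comm x z ▸ hfrom_x hz) (hfrom_x hz')

theorem exists_mem_disjoint_smul_insert (hPe : IsEdgeMatching (insert e P)) (he : e ∉ P)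
    (hcard : 1 < P.card) (hB : IsEdgeMatching B) (heB : e ∉ B)
    (hK : ∀ x y, (∃ g ∈ P, x ∈ g) → (∃ g ∈ P, y ∈ g) → swap x y ∈ K) :
    ∃ h ∈ K, Disjoint (h • insert e P) B := by
  have hfix (x y : V) (hx : ∃ g ∈ P, x ∈ g) (hy : ∃ g ∈ P, y ∈ g) :
      swap x y ∈ MulAction.stabilizer (Perm V) e := by
    have hne {u v : V} (hu : ∃ g ∈ P, u ∈ g) (hv : v ∈ e) : v ≠ u := by
      rintro rfl
      obtain ⟨g, hg, hvg⟩ := hu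
      exact hPe.notMem_of_insert he hg hvg hv
    exact smul_sym2_eq_self fun v hv => swap_apply_of_ne_of_ne (hne hx hv) (hne hy hv)
  obtain ⟨h, ⟨hhK, hhe⟩, hdisj⟩ := exists_mem_disjoint_smul
    (K := K ⊓ MulAction.stabilizer (Perm V) e) (U := {v | ∃ g ∈ P, v ∈ g})
    (fun x hx y hy => ⟨hK x y hx hy, hfix x y hx hy⟩) hB
    (hPe.subset (Finset.subset_insert e P)) (fun g hg v hv => ⟨g, hg, hv⟩) hcard
  refine ⟨h, hhK, ?_⟩
  rw [Finset.smul_finset_insert, MulAction.mem_stabilizer_iff.1 hhe, Finset.disjoint_insert_left]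
  exact ⟨heB, hdisj⟩

end Swaps

section CenterEdge

variable {V : Type*} [DecidableEq V] {N m : ℕ} {c : ZMod N → Sym2 V}
  {A : Finset (Finset (Sym2 V))}

theorem swap_mem_centerSubgroup (hm : 2 ≤ m) (hN : 2 * (m + 1) < N) (hc : c.Injective)
    (hwindow : ∀ i, IsEdgeMatching (window c (m + 1) i))
    (hcen : ∀ g : Perm V, ∃ p, IsCenter A c (m + 1) p g) (p : ZMod N) {x y : V}
    (hx : ∃ e ∈ window c m (p + 1), x ∈ e) (hy : ∃ e ∈ window c m (p + 1), y ∈ e) :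
    swap x y ∈ centerSubgroup (Perm V) A c (m + 1) p := by
  obtain ⟨q, hq⟩ : ∃ q : ZMod N, q + (m + 1 : ℕ) = p := ⟨p - (m + 1 : ℕ), sub_add_cancel _ _⟩
  have hlast : q + 1 + m = p := by
    rw [← hq]
    push_cast
    ring
  have hdisj : Disjoint (window c (m + 1) q) (window c m (p + 1)) := by
    rw [disjoint_window hc, show p + 1 = q + (m + 2 : ℕ) by rw [← hlast]; push_cast; ring]
    exact disjoint_arc_add (by omega) (by omega) q
  have hp : c p ∉ window c m (p + 1) := by
    rw [mem_window hc]
    exact notMem_arc_add_one (by omega) p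
  have hcard : 1 < (window c m (p + 1)).card := by
    rw [card_window hc (by omega)]
    omega
  have hKp := stabilizer_inf_stabilizer_le_centerSubgroup hcen
    (arc_sdiff_arc_add_one (r := m) (by omega) p)
  have hKq := stabilizer_inf_stabilizer_le_centerSubgroup hcen
    (hq ▸ arc_add_one_sdiff_arc (r := m) (by omega) q)
  rw [inf_comm] at hKq
  have hMp := hwindow p
  have hMp' := hwindow (p + 1)
  have hMq := hwindow q
  have hMq' := hwindow (q + 1)
  simp only [window_succ' m p, window_succ m (p + 1), window_succ' m q, window_succ m (q + 1),
    hlast] at hKp hKq hMp hMp' hMq hMq' hdisj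
  exact swap_mem_of_stabilizers_le hMp hMp' hMq hMq' hp hcard hdisj hKp hKq hx hy

theorem IsCenter.mem_of_isEdgeMatching (hm : 2 ≤ m) (hN : 2 * (m + 1) < N) (hc : c.Injective)
    (hwindow : ∀ i, IsEdgeMatching (window c (m + 1) i))
    (hcen : ∀ g : Perm V, ∃ p, IsCenter A c (m + 1) p g)
    (hA : (A : Set (Finset (Sym2 V))).Intersecting) {p : ZMod N}
    (hp : IsCenter A c (m + 1) p (1 : Perm V)) {B : Finset (Sym2 V)} (hBA : B ∈ A)
    (hB : IsEdgeMatching B) : c p ∈ B := by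
  by_contra hpB
  have hpP : c p ∉ window c m (p + 1) := by
    rw [mem_window hc]
    exact notMem_arc_add_one (by omega) p
  have hcard : 1 < (window c m (p + 1)).card := by
    rw [card_window hc (by omega)]
    omega
  have hM := hwindow p
  rw [window_succ'] at hM
  obtain ⟨h, hh, hdisj⟩ := exists_mem_disjoint_smul_insert hM hpP hcard hB hpB
    fun x y hx hy => swap_mem_centerSubgroup hm hN hc hwindow hcen p hx hy
  rw [← window_succ'] at hdisj
  have hmem : h • window c (m + 1) p ∈ A := by
    rw [← one_mul h, hp.mul hh p, arc_succ']
    exact Finset.mem_insert_self _ _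
  exact hA hmem hBA hdisj

end CenterEdge

section Counting

variable {V : Type*}

theorem IsEdgeMatching.empty : IsEdgeMatching (∅ : Finset (Sym2 V)) where
  not_isDiag e he := absurd he (Finset.notMem_empty e)
  eq_of_mem e he := absurd he (Finset.notMem_empty e)

variable [DecidableEq V] {W : Finset V} {r : ℕ} {M : Finset (Sym2 V)} {e : Sym2 V}

theorem IsEdgeMatching.insert (hM : IsEdgeMatching M) (he : ¬ e.IsDiag)
    (heM : ∀ f ∈ M, ∀ v ∈ f, v ∉ e) : IsEdgeMatching (insert e M) where
  not_isDiag f hf := by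
    rcases Finset.mem_insert.1 hf with rfl | hf
    exacts [he, hM.not_isDiag f hf]
  eq_of_mem f hf g hg v hvf hvg := by
    rcases Finset.mem_insert.1 hf with rfl | hfM <;> rcases Finset.mem_insert.1 hg with rfl | hgM
    exacts [rfl, absurd hvf (heM g hgM v hvg), absurd hvg (heM f hfM v hvf),
      hM.eq_of_mem f hfM g hgM v hvf hvg]

/-- The edges of the complete graph on the vertex set `W`. -/
def edgesIn (W : Finset V) : Finset (Sym2 V) :=
  {e ∈ W.sym2 | ¬ e.IsDiag}

theorem mem_edgesIn : e ∈ edgesIn W ↔ ¬ e.IsDiag ∧ ∀ v ∈ e, v ∈ W := by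
  rw [edgesIn, Finset.mem_filter, Finset.mem_sym2_iff, and_comm]

theorem card_edgesIn (W : Finset V) : (edgesIn W).card = W.card.choose 2 := by
  rw [edgesIn, Finset.sym2_eq_image, Sym2.filter_image_mk_not_isDiag, Sym2.card_image_offDiag]

open Classical in
/-- The matchings of size `r` in the complete graph on the vertex set `W`. Deleting an edge of a
matching leaves one on fewer vertices, so these are counted by recursion on `W`. -/
noncomputable def matchingsIn (W : Finset V) (r : ℕ) : Finset (Finset (Sym2 V)) :=
  {M ∈ (edgesIn W).powersetCard r | IsEdgeMatching M}

theorem mem_matchingsIn :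
    M ∈ matchingsIn W r ↔ IsEdgeMatching M ∧ M.card = r ∧ ∀ e ∈ M, ∀ v ∈ e, v ∈ W := by
  classical
  rw [matchingsIn, Finset.mem_filter, Finset.mem_powersetCard]
  constructor
  · rintro ⟨⟨hMW, hcard⟩, hM⟩
    exact ⟨hM, hcard, fun e he => (mem_edgesIn.1 (hMW he)).2⟩
  · rintro ⟨hM, hcard, hMW⟩
    exact ⟨⟨fun e he => mem_edgesIn.2 ⟨hM.not_isDiag e he, hMW e he⟩, hcard⟩, hM⟩

theorem matchingsIn_zero (W : Finset V) : matchingsIn W 0 = {∅} := by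
  ext M
  rw [mem_matchingsIn, Finset.card_eq_zero, Finset.mem_singleton]
  refine ⟨fun h => h.2.1, ?_⟩
  rintro rfl
  exact ⟨IsEdgeMatching.empty, rfl, fun e he => absurd he (Finset.notMem_empty e)⟩

theorem erase_mem_matchingsIn (hM : M ∈ matchingsIn W (r + 1)) (he : e ∈ M) :
    M.erase e ∈ matchingsIn (W \ e.toFinset) r := by
  rw [mem_matchingsIn] at hM ⊢
  obtain ⟨hM, hcard, hMW⟩ := hM
  refine ⟨hM.subset (Finset.erase_subset e M), ?_, fun f hf v hv => ?_⟩
  · rw [Finset.card_erase_of_mem he, hcard, Nat.add_sub_cancel]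
  · obtain ⟨hfe, hf⟩ := Finset.mem_erase.1 hf
    rw [Finset.mem_sdiff, Sym2.mem_toFinset]
    exact ⟨hMW f hf v hv, hM.notMem hf he hfe hv⟩

theorem notMem_of_mem_matchingsIn_sdiff (hM : M ∈ matchingsIn (W \ e.toFinset) r) : e ∉ M := by
  intro he
  have h := (mem_matchingsIn.1 hM).2.2 e he _ (Sym2.out_fst_mem e)
  exact (Finset.mem_sdiff.1 h).2 (Sym2.mem_toFinset.2 (Sym2.out_fst_mem e))

theorem insert_mem_matchingsIn (he : e ∈ edgesIn W) (hM : M ∈ matchingsIn (W \ e.toFinset) r) :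
    insert e M ∈ matchingsIn W (r + 1) := by
  have heM := notMem_of_mem_matchingsIn_sdiff hM
  rw [mem_edgesIn] at he
  simp only [mem_matchingsIn, Finset.mem_sdiff, Sym2.mem_toFinset] at hM ⊢
  obtain ⟨hM, hcard, hMW⟩ := hM
  refine ⟨hM.insert he.1 fun f hf v hv => (hMW f hf v hv).2, ?_, fun f hf => ?_⟩
  · rw [Finset.card_insert_of_notMem heM, hcard]
  · rcases Finset.mem_insert.1 hf with rfl | hf
    exacts [he.2, fun v hv => (hMW f hf v hv).1]

theorem card_filter_mem_matchingsIn (he : e ∈ edgesIn W) :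
    ({M ∈ matchingsIn W (r + 1) | e ∈ M}).card = (matchingsIn (W \ e.toFinset) r).card := by
  refine Finset.card_nbij' (fun M => M.erase e) (fun M => insert e M) ?_ ?_ ?_ ?_ <;> intro M hM
  · exact erase_mem_matchingsIn (Finset.mem_filter.1 hM).1 (Finset.mem_filter.1 hM).2
  · exact Finset.mem_filter.2 ⟨insert_mem_matchingsIn he hM, Finset.mem_insert_self e M⟩
  · exact Finset.insert_erase (Finset.mem_filter.1 hM).2
  · exact Finset.erase_insert (notMem_of_mem_matchingsIn_sdiff hM)

theorem sum_card_filter_mem_matchingsIn (W : Finset V) (r : ℕ) :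
    ∑ e ∈ edgesIn W, ({M ∈ matchingsIn W r | e ∈ M}).card = (matchingsIn W r).card * r := by
  refine (Finset.sum_card_bipartiteAbove_eq_sum_card_bipartiteBelow
    fun (M : Finset (Sym2 V)) e => e ∈ M).symm.trans (Finset.sum_const_nat fun M hM => ?_)
  obtain ⟨hM, hcard, hMW⟩ := mem_matchingsIn.1 hM
  rw [Finset.bipartiteAbove, Finset.filter_mem_eq_inter, Finset.inter_eq_right.2 ?_, hcard]
  exact fun e he => mem_edgesIn.2 ⟨hM.not_isDiag e he, hMW e he⟩

theorem card_sdiff_toFinset (he : e ∈ edgesIn W) : (W \ e.toFinset).card = W.card - 2 := by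
  rw [mem_edgesIn] at he
  rw [Finset.card_sdiff_of_subset fun v hv => he.2 v (Sym2.mem_toFinset.1 hv),
    Sym2.card_toFinset_of_not_isDiag e he.1]

theorem card_matchingsIn_mul_factorial (W : Finset V) (r : ℕ) :
    (matchingsIn W r).card * r.factorial = ∏ i ∈ Finset.range r, (W.card - 2 * i).choose 2 := by
  induction r generalizing W with
  | zero =>
    rw [matchingsIn_zero, Finset.card_singleton, Nat.factorial_zero,
      Finset.prod_range_zero, mul_one]
  | succ r ih =>
    have hterm (i : ℕ) : W.card - 2 * (i + 1) = W.card - 2 - 2 * i := by omega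
    have hstar : ∀ e ∈ edgesIn W, ({M ∈ matchingsIn W (r + 1) | e ∈ M}).card * r.factorial =
        ∏ i ∈ Finset.range r, (W.card - 2 * (i + 1)).choose 2 := fun e he => by
      simp only [card_filter_mem_matchingsIn he, ih, card_sdiff_toFinset he, hterm]
    rw [Nat.factorial_succ, ← mul_assoc, ← sum_card_filter_mem_matchingsIn, Finset.sum_mul,
      Finset.sum_congr rfl hstar, Finset.sum_const, smul_eq_mul, card_edgesIn, mul_comm,
      Finset.prod_range_succ', mul_zero, Nat.sub_zero]

end Counting

section Stars

variable {n r : ℕ} {M : Finset (Sym2 (Fin (2 * n)))} {e : Sym2 (Fin (2 * n))}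

theorem mem_rMatchings : M ∈ rMatchings n r ↔ IsEdgeMatching M ∧ M.card = r := by
  rw [rMatchings, Finset.mem_filter, Finset.mem_powersetCard]
  constructor
  · rintro ⟨⟨hM, hcard⟩, hdisj⟩
    refine ⟨⟨fun e he => ?_, fun e he f hf v hv hv' => ?_⟩, hcard⟩
    · simpa using hM he
    · by_contra hne
      exact hdisj e he f hf hne v hv hv'
  · rintro ⟨hM, hcard⟩
    refine ⟨⟨fun e he => ?_, hcard⟩, fun e he f hf hne v hv => hM.notMem he hf hne hv⟩
    simpa using hM.not_isDiag e he

theorem rMatchings_eq_matchingsIn (n r : ℕ) : rMatchings n r = matchingsIn Finset.univ r := by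
  ext M
  simp only [mem_rMatchings, mem_matchingsIn, Finset.mem_univ, implies_true, and_true]

theorem mem_edgeFinset_top_iff :
    e ∈ (⊤ : SimpleGraph (Fin (2 * n))).edgeFinset ↔ e ∈ edgesIn Finset.univ := by
  simp [mem_edgesIn]

theorem matchingPhi_succ (n r : ℕ) : matchingPhi n (r + 1) =
    ((∏ i ∈ Finset.range r, (2 * n - 2 - 2 * i).choose 2 : ℕ) : ℚ) / r.factorial := by
  rw [matchingPhi, Nat.add_sub_cancel, Nat.cast_prod, ← Finset.Ico_add_one_right_eq_Icc,
    Finset.range_eq_Ico]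
  have hshift := Finset.prod_Ico_add' (fun i => (((2 * n - 2 * i).choose 2 : ℕ) : ℚ)) 0 r 1
  refine congrArg (· / (r.factorial : ℚ)) (hshift.symm.trans (Finset.prod_congr rfl fun i _ => ?_))
  rw [Nat.sub_sub, show 2 + 2 * i = 2 * (i + 1) by ring]

theorem card_matchingStar (hr : 1 ≤ r) (he : e ∈ edgesIn Finset.univ) :
    ((matchingStar n r e).card : ℚ) = matchingPhi n r := by
  obtain ⟨r, rfl⟩ := Nat.exists_eq_add_of_le' hr
  have h := card_matchingsIn_mul_factorial (Finset.univ \ e.toFinset) r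
  rw [← card_filter_mem_matchingsIn he, ← rMatchings_eq_matchingsIn, card_sdiff_toFinset he,
    Finset.card_univ, Fintype.card_fin] at h
  rw [matchingPhi_succ, ← h, Nat.cast_mul, mul_div_cancel_right₀ _ (by positivity), matchingStar]

theorem card_matchingStar_eq (hr : 1 ≤ r) {f : Sym2 (Fin (2 * n))}
    (he : e ∈ edgesIn Finset.univ) (hf : f ∈ edgesIn Finset.univ) :
    (matchingStar n r e).card = (matchingStar n r f).card := by
  rw [← Nat.cast_inj (R := ℚ), card_matchingStar hr he, card_matchingStar hr hf]

theorem mul_card_matchingStar (hr : 1 ≤ r) (he : e ∈ edgesIn Finset.univ) :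
    n * (2 * n - 1) * (matchingStar n r e).card = r * (rMatchings n r).card := by
  have hsum := sum_card_filter_mem_matchingsIn (Finset.univ : Finset (Fin (2 * n))) r
  rw [← rMatchings_eq_matchingsIn] at hsum
  have hstar : ∀ f ∈ edgesIn (Finset.univ : Finset (Fin (2 * n))),
      (matchingStar n r f).card = (matchingStar n r e).card :=
    fun f hf => card_matchingStar_eq hr hf he
  have hcard : (edgesIn (Finset.univ : Finset (Fin (2 * n)))).card = n * (2 * n - 1) := by
    rw [card_edgesIn, Finset.card_univ, Fintype.card_fin, Nat.choose_two_right, mul_assoc,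
      Nat.mul_div_cancel_left _ two_pos]
  rw [← hcard, ← Finset.sum_const_nat hstar, mul_comm r]
  exact hsum

theorem orbit_eq_rMatchings (hM : M ∈ rMatchings n r) :
    MulAction.orbit (Perm (Fin (2 * n))) M = rMatchings n r := by
  rw [mem_rMatchings] at hM
  ext M'
  rw [Finset.mem_coe, mem_rMatchings]
  constructor
  · rintro ⟨g, rfl⟩
    exact ⟨hM.1.smul g, (Finset.card_smul_finset g M).trans hM.2⟩
  · rintro ⟨hM', hcard⟩
    exact hM.1.exists_smul_eq hM' (hM.2.trans hcard.symm)

end Stars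

section RoundRobin

/-- Match number `t` in round `j` of the round-robin tournament on `ZMod m` and one extra player:
the sum of the two players is `2 * j`, except that the extra player replaces one copy of `j` in the
pair `{j, j}`. -/
def roundRobinMatch {m : ℕ} (j : ZMod m) (t : ℕ) : Sym2 (Option (ZMod m)) :=
  s(if t = 0 then none else some (j + t), some (j - t))

variable {m n : ℕ}

theorem none_mem_roundRobinMatch {j : ZMod m} {t : ℕ} : none ∈ roundRobinMatch j t ↔ t = 0 := by
  rw [roundRobinMatch, Sym2.mem_iff]
  split_ifs with h <;> simp [h]

theorem some_mem_roundRobinMatch {j x : ZMod m} {t : ℕ} :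
    some x ∈ roundRobinMatch j t ↔ x = j + t ∨ x = j - t := by
  rw [roundRobinMatch, Sym2.mem_iff]
  split_ifs with h <;> simp [h]

theorem not_isDiag_roundRobinMatch (j : ZMod m) {t : ℕ} (ht : 2 * t < m) :
    ¬ (roundRobinMatch j t).IsDiag := by
  rw [roundRobinMatch, Sym2.mk_isDiag_iff]
  split_ifs with h
  · exact not_false
  · intro heq
    have h2t : ((2 * t : ℕ) : ZMod m) = (0 : ℕ) := by
      push_cast
      linear_combination Option.some.inj heq
    have := natCast_zmod_inj ht (by omega) h2t
    omega

theorem notMem_roundRobinMatch_of_lt {j : ZMod m} {t u : ℕ} (htu : t < u) (hu : 2 * u < m)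
    {v : Option (ZMod m)} (hv : v ∈ roundRobinMatch j t) : v ∉ roundRobinMatch j u := by
  intro hv'
  cases v with
  | none =>
    rw [none_mem_roundRobinMatch] at hv hv'
    omega
  | some x =>
    have hne : ((t : ℕ) : ZMod m) ≠ u := fun h => htu.ne (natCast_zmod_inj (by omega) (by omega) h)
    have hadd : ((t + u : ℕ) : ZMod m) ≠ (0 : ℕ) := fun h => by
      have := natCast_zmod_inj (by omega) (by omega) h
      omega
    push_cast at hadd
    rcases some_mem_roundRobinMatch.1 hv with rfl | rfl <;>
      rcases some_mem_roundRobinMatch.1 hv' with h | h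
    · exact hne (by linear_combination h)
    · exact hadd (by linear_combination h)
    · exact hadd (by linear_combination -h)
    · exact hne (by linear_combination -h)

theorem notMem_roundRobinMatch_add_one {j : ZMod m} {t u : ℕ} (hut : u + 1 < t) (ht : 2 * t < m)
    {v : Option (ZMod m)} (hv : v ∈ roundRobinMatch j t) : v ∉ roundRobinMatch (j + 1) u := by
  intro hv'
  cases v with
  | none =>
    rw [none_mem_roundRobinMatch] at hv
    omega
  | some x =>
    have hne {a b : ℕ} (ha : a < m) (hab : b < a) : (a : ZMod m) ≠ b :=
      fun h => hab.ne' (natCast_zmod_inj ha (hab.trans ha) h)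
    have h₁ := hne (a := t) (b := u + 1) (by omega) (by omega)
    have h₂ := hne (a := t + u) (b := 1) (by omega) (by omega)
    have h₃ := hne (a := t + u + 1) (b := 0) (by omega) (by omega)
    have h₄ := hne (a := t + 1) (b := u) (by omega) (by omega)
    push_cast at h₁ h₂ h₃ h₄
    rcases some_mem_roundRobinMatch.1 hv with rfl | rfl <;>
      rcases some_mem_roundRobinMatch.1 hv' with h | h
    · exact h₁ (by linear_combination h)
    · exact h₂ (by linear_combination h)
    · exact h₃ (by linear_combination -h)
    · exact h₄ (by linear_combination -h)

theorem eq_of_roundRobinMatch_eq (hm : Odd m) {j k : ZMod m} {t u : ℕ}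
    (h : roundRobinMatch j t = roundRobinMatch k u) : j = k := by
  have htu : t = 0 ↔ u = 0 := by
    rw [← none_mem_roundRobinMatch (j := j), h, none_mem_roundRobinMatch]
  rw [roundRobinMatch, roundRobinMatch, Sym2.eq_iff] at h
  by_cases ht : t = 0
  · simpa [ht, htu.1 ht] using h
  · rw [if_neg ht, if_neg (htu.not.1 ht)] at h
    simp only [Option.some_inj] at h
    have htwo : IsUnit (2 : ZMod m) :=
      (ZMod.isUnit_iff_coprime 2 m).2 (Nat.coprime_two_left.2 hm)
    refine htwo.mul_left_cancel ?_
    rcases h with ⟨h₁, h₂⟩ | ⟨h₁, h₂⟩ <;> linear_combination h₁ + h₂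

theorem roundRobinMatch_inj (hm : Odd m) {j k : ZMod m} {t u : ℕ} (ht : 2 * t < m)
    (hu : 2 * u < m) : roundRobinMatch j t = roundRobinMatch k u ↔ j = k ∧ t = u := by
  refine ⟨fun h => ?_, fun ⟨hj, ht⟩ => hj ▸ ht ▸ rfl⟩
  obtain rfl := eq_of_roundRobinMatch_eq hm h
  have hmem : some (j - t) ∈ roundRobinMatch j t := Sym2.mem_mk_right _ _
  refine ⟨rfl, (lt_trichotomy t u).resolve_left (fun htu => ?_) |>.resolve_right fun hut => ?_⟩
  · exact notMem_roundRobinMatch_of_lt htu hu hmem (h ▸ hmem)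
  · exact notMem_roundRobinMatch_of_lt hut ht (h ▸ hmem) hmem

/-- The matches of the round-robin tournament between `2 * n` players, played one after the other
and round by round; this is the cyclic arrangement of the edges of the complete graph. -/
def roundRobin (n : ℕ) (i : ZMod (n * (2 * n - 1))) : Sym2 (Option (ZMod (2 * n - 1))) :=
  roundRobinMatch ((i.val / n : ℕ) : ZMod (2 * n - 1)) (i.val % n)

theorem roundRobin_natCast {t : ℕ} (ht : t < n) (j : ℕ) :
    roundRobin n ((t + n * j : ℕ) : ZMod (n * (2 * n - 1))) = roundRobinMatch (j : ZMod _) t := by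
  rw [roundRobin, ZMod.val_natCast, Nat.mod_mul_right_mod, Nat.mod_mul_right_div_self,
    ZMod.natCast_mod, Nat.add_mul_mod_self_left, Nat.mod_eq_of_lt ht,
    Nat.add_mul_div_left _ _ (by omega), Nat.div_eq_of_lt ht, Nat.zero_add]

theorem exists_eq_natCast_add_mul (hn : 0 < n) (i : ZMod (n * (2 * n - 1))) :
    ∃ t < n, ∃ j < 2 * n - 1, i = (t + n * j : ℕ) := by
  have : NeZero (n * (2 * n - 1)) := ⟨Nat.mul_ne_zero (by omega) (by omega)⟩
  refine ⟨i.val % n, Nat.mod_lt _ hn, i.val / n, Nat.div_lt_of_lt_mul (ZMod.val_lt i), ?_⟩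
  rw [Nat.mod_add_div, ZMod.natCast_zmod_val]

theorem not_isDiag_roundRobin (hn : 0 < n) (i : ZMod (n * (2 * n - 1))) :
    ¬ (roundRobin n i).IsDiag := by
  obtain ⟨t, ht, j, -, rfl⟩ := exists_eq_natCast_add_mul hn i
  rw [roundRobin_natCast ht]
  exact not_isDiag_roundRobinMatch _ (by omega)

theorem roundRobin_injective (hn : 0 < n) : (roundRobin n).Injective := by
  intro i i' h
  obtain ⟨t, ht, j, hj, rfl⟩ := exists_eq_natCast_add_mul hn i
  obtain ⟨t', ht', j', hj', rfl⟩ := exists_eq_natCast_add_mul hn i'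
  have hodd : Odd (2 * n - 1) := Nat.odd_iff.2 (by omega)
  rw [roundRobin_natCast ht, roundRobin_natCast ht',
    roundRobinMatch_inj hodd (by omega) (by omega)] at h
  rw [natCast_zmod_inj hj hj' h.1, h.2]

theorem notMem_roundRobin_add {k : ℕ} (hk : 0 < k) (hkn : k + 1 < n) (i : ZMod (n * (2 * n - 1)))
    {v : Option (ZMod (2 * n - 1))} (hv : v ∈ roundRobin n i) : v ∉ roundRobin n (i + k) := by
  obtain ⟨t, ht, j, -, rfl⟩ := exists_eq_natCast_add_mul (by omega) i
  rw [roundRobin_natCast ht] at hv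
  rw [← Nat.cast_add]
  rcases lt_or_ge (t + k) n with h | h
  · rw [Nat.add_right_comm, roundRobin_natCast h]
    exact notMem_roundRobinMatch_of_lt (by omega) (by omega) hv
  · obtain ⟨u, hu⟩ := Nat.exists_eq_add_of_le' h
    rw [show t + n * j + k = u + n * (j + 1) by linear_combination hu,
      roundRobin_natCast (by omega), Nat.cast_add, Nat.cast_one]
    exact notMem_roundRobinMatch_add_one (by omega) (by omega) hv

theorem isEdgeMatching_window {V : Type*} [DecidableEq V] {N r : ℕ} {c : ZMod N → Sym2 V}
    (hdiag : ∀ i, ¬ (c i).IsDiag)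
    (hc : ∀ i, ∀ k : ℕ, 0 < k → k < r → ∀ v ∈ c i, v ∉ c (i + k)) (i : ZMod N) :
    IsEdgeMatching (window c r i) := by
  have hmem : ∀ e ∈ window c r i, ∃ a < r, c (i + (a : ℕ)) = e := by
    intro e he
    obtain ⟨p, hp, rfl⟩ := Finset.mem_image.1 he
    obtain ⟨a, ha, rfl⟩ := mem_arc.1 hp
    exact ⟨a, ha, rfl⟩
  have hlt {a b : ℕ} (hab : a < b) (hb : b < r) {v : V} (hv : v ∈ c (i + a)) : v ∉ c (i + b) := by
    have := hc (i + a) (b - a) (by omega) (by omega) v hv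
    rwa [add_assoc, ← Nat.cast_add, Nat.add_sub_cancel' hab.le] at this
  constructor
  · intro e he
    obtain ⟨a, -, rfl⟩ := hmem e he
    exact hdiag _
  · intro e he f hf v hve hvf
    obtain ⟨a, ha, rfl⟩ := hmem e he
    obtain ⟨b, hb, rfl⟩ := hmem f hf
    rcases lt_trichotomy a b with hab | rfl | hab
    exacts [absurd hvf (hlt hab hb hve), rfl, absurd hve (hlt hab ha hvf)]

theorem exists_injective_isEdgeMatching_window {r : ℕ} (hrn : r < n) :
    ∃ c : ZMod (n * (2 * n - 1)) → Sym2 (Fin (2 * n)),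
      c.Injective ∧ ∀ i, IsEdgeMatching (window c r i) := by
  have : NeZero (2 * n - 1) := ⟨by omega⟩
  have hcard : Fintype.card (Option (ZMod (2 * n - 1))) = Fintype.card (Fin (2 * n)) := by
    rw [Fintype.card_option, ZMod.card, Fintype.card_fin]
    omega
  let φ := Fintype.equivOfCardEq hcard
  refine ⟨fun i => (roundRobin n i).map φ,
    (Sym2.map.injective φ.injective).comp (roundRobin_injective (by omega)),
    isEdgeMatching_window (fun i h => ?_) fun i k hk hkr v hv hv' => ?_⟩
  · exact not_isDiag_roundRobin (by omega) i ((Sym2.isDiag_map φ.injective).1 h)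
  · obtain ⟨x, hx, rfl⟩ := Sym2.mem_map.1 hv
    obtain ⟨y, hy, hxy⟩ := Sym2.mem_map.1 hv'
    exact notMem_roundRobin_add hk (by omega) i hx (φ.injective hxy ▸ hy)

end RoundRobin

section SmallWindows

variable {α : Type*} [DecidableEq α] {A : Finset (Finset α)}

theorem card_le_three_of_triangle (hA : (A : Set (Finset α)).Intersecting)
    (hcard : ∀ M ∈ A, M.card = 2) {x y z : α} (hxy : {x, y} ∈ A) (hxz : {x, z} ∈ A)
    (hyz : {y, z} ∈ A) : A.card ≤ 3 := by
  have hsub : A ⊆ ({x, y, z} : Finset α).powersetCard 2 := by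
    refine fun M hM => Finset.mem_powersetCard.2 ⟨fun u hu => ?_, hcard M hM⟩
    by_contra huT
    simp only [Finset.mem_insert, Finset.mem_singleton, not_or] at huT
    obtain ⟨w, hw⟩ : ∃ w, M.erase u = {w} :=
      Finset.card_eq_one.1 (by rw [Finset.card_erase_of_mem hu, hcard M hM])
    have hmeet {a b : α} (hab : {a, b} ∈ A) (ha : u ≠ a) (hb : u ≠ b) : w = a ∨ w = b := by
      obtain ⟨v, hvM, hv⟩ := Finset.not_disjoint_iff.1 (hA hM hab)
      have hvu : v ≠ u := by
        rintro rfl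
        simp only [Finset.mem_insert, Finset.mem_singleton] at hv
        exact hv.elim ha hb
      obtain rfl := Finset.mem_singleton.1 (hw ▸ Finset.mem_erase.2 ⟨hvu, hvM⟩)
      simpa using hv
    have hne {a b : α} (hab : {a, b} ∈ A) : a ≠ b := Finset.card_pair_eq_two_iff.1 (hcard _ hab)
    have := hmeet hxy huT.1 huT.2.1
    have := hmeet hxz huT.1 huT.2.2
    have := hmeet hyz huT.2.1 huT.2.2
    grind
  calc A.card ≤ (({x, y, z} : Finset α).powersetCard 2).card := Finset.card_le_card hsub
    _ ≤ Nat.choose 3 2 := by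
      rw [Finset.card_powersetCard]
      exact Nat.choose_le_choose 2 Finset.card_le_three

theorem mem_of_pair_mem_of_pair_mem (hA : (A : Set (Finset α)).Intersecting)
    (hcard : ∀ M ∈ A, M.card = 2) (hA3 : 3 < A.card) {x y z : α} (hyz : y ≠ z)
    (hxy : {x, y} ∈ A) (hxz : {x, z} ∈ A) {B : Finset α} (hB : B ∈ A) : x ∈ B := by
  by_contra hxB
  have hmem {w : α} (hxw : {x, w} ∈ A) : w ∈ B := by
    by_contra hwB
    refine hA hxw hB ?_
    rw [Finset.disjoint_insert_left, Finset.disjoint_singleton_left]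
    exact ⟨hxB, hwB⟩
  have hpair : {y, z} = B := by
    refine Finset.eq_of_subset_of_card_le ?_ (by rw [hcard B hB, Finset.card_pair hyz])
    exact Finset.insert_subset (hmem hxy) (Finset.singleton_subset_iff.2 (hmem hxz))
  exact hA3.not_ge (card_le_three_of_triangle hA hcard hxy hxz (hpair ▸ hB))

variable {G : Type*} [Group G] [MulAction G α] {N r : ℕ} {c : ZMod N → α} {p : ZMod N}

theorem IsCenter.window_mem (hp : IsCenter A c r p (1 : G)) {i : ZMod N} (hi : p ∈ arc r i) :
    window c r i ∈ A :=
  one_smul G (window c r i) ▸ (hp i).2 hi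

theorem IsCenter.mem_of_one (hA : (A : Set (Finset α)).Intersecting)
    (hp : IsCenter A c 1 p (1 : G)) {B : Finset α} (hB : B ∈ A) : c p ∈ B := by
  have hmem : window c 1 p ∈ A := hp.window_mem (arc_succ' 0 p ▸ Finset.mem_insert_self _ _)
  obtain ⟨e, he, heB⟩ := Finset.not_disjoint_iff.1 (hA hmem hB)
  have : e = c p := by simpa [window, arc] using he
  exact this ▸ heB

theorem IsCenter.mem_of_two (hN : 2 < N) (hc : c.Injective)
    (hA : (A : Set (Finset α)).Intersecting) (hcard : ∀ M ∈ A, M.card = 2) (hA3 : 3 < A.card)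
    (hp : IsCenter A c 2 p (1 : G)) {B : Finset α} (hB : B ∈ A) : c p ∈ B := by
  have hwindow (i : ZMod N) : window c 2 i = {c i, c (i + 1)} := by
    rw [window_succ', window_succ', window, arc]
    rfl
  have hnext : {c p, c (p + 1)} ∈ A := by
    rw [← hwindow]
    exact hp.window_mem (arc_succ' 1 p ▸ Finset.mem_insert_self _ _)
  have hprev : {c p, c (p - 1)} ∈ A := by
    have hmem : p ∈ arc 2 (p - 1) := mem_arc.2 ⟨1, one_lt_two, by rw [Nat.cast_one, sub_add_cancel]⟩
    have := hp.window_mem hmem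
    rwa [hwindow, sub_add_cancel, Finset.pair_comm] at this
  refine mem_of_pair_mem_of_pair_mem hA hcard hA3 (fun h => ?_) hnext hprev hB
  have htwo : ((2 : ℕ) : ZMod N) = (0 : ℕ) := by
    push_cast
    linear_combination hc h
  exact two_ne_zero (natCast_zmod_inj hN (by omega) htwo)

end SmallWindows

section Extremal

variable {n r : ℕ} {𝒜 : Finset (Finset (Sym2 (Fin (2 * n))))} {e : Sym2 (Fin (2 * n))}

theorem two_mul_lt_card_edges (hr : 1 ≤ r) (hrn : r < n) : 2 * r < n * (2 * n - 1) :=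
  calc 2 * r < 2 * (2 * n - 1) := by omega
    _ ≤ n * (2 * n - 1) := Nat.mul_le_mul_right _ (by omega)

theorem orbit_window_eq_rMatchings (hr : 1 ≤ r) (hrn : r < n)
    {c : ZMod (n * (2 * n - 1)) → Sym2 (Fin (2 * n))} (hc : c.Injective)
    (hwindow : ∀ i, IsEdgeMatching (window c r i)) (i : ZMod (n * (2 * n - 1))) :
    MulAction.orbit (Perm (Fin (2 * n))) (window c r i) = rMatchings n r := by
  have := two_mul_lt_card_edges hr hrn
  exact orbit_eq_rMatchings (mem_rMatchings.2 ⟨hwindow i, card_window hc (by omega) i⟩)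

theorem card_le_card_matchingStar (hr : 1 ≤ r) (hrn : r < n) (h𝒜 : 𝒜 ⊆ rMatchings n r)
    (hint : (𝒜 : Set (Finset (Sym2 (Fin (2 * n))))).Intersecting) (he : e ∈ edgesIn Finset.univ) :
    𝒜.card ≤ (matchingStar n r e).card := by
  obtain ⟨c, hc, hwindow⟩ := exists_injective_isEdgeMatching_window hrn
  have hN := two_mul_lt_card_edges hr hrn
  have : NeZero (n * (2 * n - 1)) := ⟨by omega⟩
  have hcard := mul_card_le_of_intersecting hc hN.le (orbit_window_eq_rMatchings hr hrn hc hwindow)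
    h𝒜 hint
  rw [← mul_card_matchingStar hr he] at hcard
  exact Nat.le_of_mul_le_mul_left hcard (by omega)

theorem three_lt_card_matchingStar_two (hn : 2 < n) (he : e ∈ edgesIn Finset.univ) :
    3 < (matchingStar n 2 e).card := by
  have hcard : (matchingStar n 2 e).card = (2 * n - 2).choose 2 := by
    rw [← Nat.cast_inj (R := ℚ), card_matchingStar one_le_two he]
    simp [matchingPhi]
  calc 3 < Nat.choose 4 2 := by decide
    _ ≤ (2 * n - 2).choose 2 := Nat.choose_le_choose 2 (by omega)
    _ = (matchingStar n 2 e).card := hcard.symm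

theorem exists_forall_mem_of_card_eq (hr : 1 ≤ r) (hrn : r < n) (h𝒜 : 𝒜 ⊆ rMatchings n r)
    (hint : (𝒜 : Set (Finset (Sym2 (Fin (2 * n))))).Intersecting) (he : e ∈ edgesIn Finset.univ)
    (hcard : 𝒜.card = (matchingStar n r e).card) :
    ∃ f ∈ edgesIn (Finset.univ : Finset (Fin (2 * n))), ∀ B ∈ 𝒜, f ∈ B := by
  obtain ⟨c, hc, hwindow⟩ := exists_injective_isEdgeMatching_window hrn
  have hN := two_mul_lt_card_edges hr hrn
  have : NeZero (n * (2 * n - 1)) := ⟨by omega⟩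
  have hcen := exists_isCenter hc hr hN (orbit_window_eq_rMatchings hr hrn hc hwindow) h𝒜 hint
    (hcard ▸ mul_card_matchingStar hr he)
  obtain ⟨p, hp⟩ := hcen 1
  have hmem : c p ∈ window c r p :=
    (mem_window hc).2 (mem_arc.2 ⟨0, hr, by rw [Nat.cast_zero, add_zero]⟩)
  refine ⟨c p, ?_, fun B hB => ?_⟩
  · exact mem_edgesIn.2 ⟨(hwindow p).not_isDiag _ hmem, fun v _ => Finset.mem_univ v⟩
  obtain rfl | rfl | ⟨m, hm, rfl⟩ : r = 1 ∨ r = 2 ∨ ∃ m, 2 ≤ m ∧ r = m + 1 := by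
    rcases (by omega : r = 1 ∨ r = 2 ∨ 3 ≤ r) with h | h | h
    exacts [.inl h, .inr (.inl h), .inr (.inr ⟨r - 1, by omega, by omega⟩)]
  · exact hp.mem_of_one hint hB
  · exact hp.mem_of_two (by omega) hc hint (fun M hM => (mem_rMatchings.1 (h𝒜 hM)).2)
      (hcard ▸ three_lt_card_matchingStar_two hrn he) hB
  · exact hp.mem_of_isEdgeMatching hm hN hc hwindow hcen hint hB (mem_rMatchings.1 (h𝒜 hB)).1

theorem card_eq_card_matchingStar_iff (hr : 1 ≤ r) (hrn : r < n) (h𝒜 : 𝒜 ⊆ rMatchings n r)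
    (hint : (𝒜 : Set (Finset (Sym2 (Fin (2 * n))))).Intersecting) (he : e ∈ edgesIn Finset.univ) :
    𝒜.card = (matchingStar n r e).card ↔
      ∃ f ∈ edgesIn (Finset.univ : Finset (Fin (2 * n))), 𝒜 = matchingStar n r f := by
  constructor
  · intro hcard
    obtain ⟨f, hf, hmem⟩ := exists_forall_mem_of_card_eq hr hrn h𝒜 hint he hcard
    refine ⟨f, hf, Finset.eq_of_subset_of_card_le (fun B hB => ?_) ?_⟩
    · exact Finset.mem_filter.2 ⟨h𝒜 hB, hmem B hB⟩
    · rw [hcard, card_matchingStar_eq hr hf he]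
  · rintro ⟨f, hf, rfl⟩
    exact card_matchingStar_eq hr hf he

end Extremal

theorem theorem2 (n r : ℕ) (hr : 1 ≤ r) (hrn : r < n)
    (𝒜 : Finset (Finset (Sym2 (Fin (2 * n))))) (h𝒜 : 𝒜 ⊆ rMatchings n r)
    (hint : (𝒜 : Set (Finset (Sym2 (Fin (2 * n))))).Intersecting) :
    (𝒜.card : ℚ) ≤ matchingPhi n r ∧
      ((𝒜.card : ℚ) = matchingPhi n r ↔
        ∃ e ∈ (⊤ : SimpleGraph (Fin (2 * n))).edgeFinset, 𝒜 = matchingStar n r e) := by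
  obtain ⟨e, he⟩ : (edgesIn (Finset.univ : Finset (Fin (2 * n)))).Nonempty := by
    rw [← Finset.card_pos, card_edgesIn, Finset.card_univ, Fintype.card_fin]
    exact Nat.choose_pos (by omega)
  simp only [← card_matchingStar hr he, Nat.cast_le, Nat.cast_inj, mem_edgeFinset_top_iff]
  exact ⟨card_le_card_matchingStar hr hrn h𝒜 hint he,
    card_eq_card_matchingStar_iff hr hrn h𝒜 hint he⟩
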